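/- Let $\lambda=(\lambda_1\ge\lambda_2\ge\dots\ge\lambda_\ell>0)$ be a partition (possibly empty) all of whose parts are odd. Write $\lambda_i=2n_i+1$, let $\ell=\ell(\lambda)$ be its length, $|\lambda|=\lambda_1+\dots+\lambda_\ell$ its weight, and $m_i$ ($i=1,3,5,\dots$) the multiplicity of $i$ in $\lambda$. *The function $C_\lambda$.* Let $\phi_j$, $j\in\frac12+\mathbb Z$, be free bosons, $\phi_i\phi_j-\phi_j\phi_i=(-1)^{j-\frac12}\delta_{i,-j}$, acting on the bosonic Fock space with vacuum $|0\rangle$, where $\phi_j|0\rangle=0$ for $j<0$ and $\langle0|\phi_j=0$ for $j>0$, $\langle 0|0\rangle=1$; the vectors $\phi_{j_1}^{a_1}\cdots\phi_{j_r}^{a_r}|0\rangle$ with $j_1>\dots>j_r>0$ form a basis. For odd $n$ put $J_n=\frac12\sum_{j\in\frac12+\mathbb Z}(-1)^{j+\frac12}\phi_j\phi_{-j-n}$, and for $t=(t_1,t_3,t_5,\dots)$ put $\Gamma(t)=\exp\big(\sum_{n>0\text{ odd}}t_nJ_n\big)$. Let $d_\lambda$ be a complex number (either choice of the square root) with $$d_\lambda^2=(-1)^{\sum_i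 n_i}\prod_{i=1,3,5,\dots}m_i!,$$ and put $|\lambda\rangle=\frac1{d_\lambda}\phi_{\lambda_1/2}\cdots\phi_{\lambda_\ell/2}|0\rangle$ and $C_\lambda(t)=\langle 0|\Gamma(t)|\lambda\rangle$. *The number $N_{0\to\lambda}$.* Consider baskets numbered $1,3,5,\dots$, all empty at time $0$. At each time step one of the following happens: either two balls are created in basket $1$, or one ball is chosen among all balls present and is moved from its basket $i$ to the basket $i+2$ (so a move out of a basket with $m$ balls can be made in $m$ ways). Let $N_{0\to\lambda}$ be the number of ways to reach in $\frac12|\lambda|$ steps the configuration with $m_i$ balls in basket $i$ for every $i$. *Claim.* If $\ell$ is even, then $$C_\lambda(1,0,0,\dots)=\Big(\frac12\Big)^{\ell/2}\,\frac{1}{(|\lambda|/2)!}\,\frac{\prod_{i}m_i!}{d_\lambda}\,N_{0\to\lambda},$$ $$C_\lambda(1,0,0,\dots)=\frac1{d_\lambda}\,\mathrm{Hf}\Big[\frac1{n_i!\,n_j!\,(n_i+n_j+1)}\Big]_{1\le i,j\le\ell},$$ and hence $$N_{0\to\lambda}=2^{\ell/2}\,\Big(\frac{|\lambda|}2\Big)!\,\Big(\prod_{i=1,3,5,\dots}\frac1{m_i!}\Big)\,\mathrm{Hf}\Big[\frac1{n_i!\,n_j!\,(n_i+n_j+1)}\Big]_{1\le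 i,j\le\ell}.$$ Here, for a symmetric $2k\times2k$ matrix $A$, $\mathrm{Hf}(A)=\sum_\sigma A_{\sigma(1),\sigma(2)}\cdots A_{\sigma(2k-1),\sigma(2k)}$, the sum being over all permutations $\sigma$ of $\{1,\dots,2k\}$ with $\sigma(2i-1)<\sigma(2i)$ for all $i$ and $\sigma(1)<\sigma(3)<\dots<\sigma(2k-1)$. If $\ell$ is odd, then $C_\lambda(1,0,0,\dots)=0$ and the configuration $\lambda$ cannot be reached from the empty one in any number of steps. -/

import Mathlib

open scoped Nat

/-! ### The bosonic Fock space

The Fock space of the free bosons `φ_j`, `j ∈ 1/2 + ℤ`, with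
`φ_i φ_j - φ_j φ_i = (-1)^(j - 1/2) δ_{i,-j}` and `φ_j |0⟩ = 0` for `j < 0`, realized on the
polynomials in the variables `z_{m + 1/2} = X m`, `m = 0, 1, 2, …`. Its monomials are the vectors
`φ_{j_1}^{m_1} ⋯ φ_{j_n}^{m_n} |0⟩` with `j_1 > ⋯ > j_n > 0`.
The half-integer `a + 1/2` is encoded by the integer `a`. -/

/-- The bosonic Fock space. -/
abbrev Fock : Type := MvPolynomial ℕ ℂ

/-- The vacuum vector `|0⟩`. -/
noncomputable def vacuum : Fock := 1

/-- The left vacuum `⟨0|`: it satisfies `⟨0|0⟩ = 1` and `⟨0| φ_j = 0` for `j > 0`. -/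
noncomputable def leftVacuum : Fock →ₗ[ℂ] ℂ := (MvPolynomial.aeval (fun _ => (0 : ℂ))).toLinearMap

/-- The boson `φ_{a + 1/2}`: multiplication by `z_{m + 1/2}` if `a = m ≥ 0`, and
`(-1)^m ∂/∂z_{m + 1/2}` if `a + 1/2 = -(m + 1/2)` with `m ≥ 0`. -/
noncomputable def boson : ℤ → Fock →ₗ[ℂ] Fock
  | Int.ofNat m => LinearMap.mulLeft ℂ (MvPolynomial.X m)
  | Int.negSucc m => ((-1 : ℂ) ^ m) • (MvPolynomial.pderiv m).toLinearMap

/-- The summand `(-1)^(j + 1/2) φ_j φ_{-j-n}` of the current `J_n`, for `j = a + 1/2`. -/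
noncomputable def currentTerm (n a : ℤ) : Fock →ₗ[ℂ] Fock :=
  ((-1 : ℂ) ^ (a + 1)) • (boson a ∘ₗ boson (-a - n - 1))

theorem currentTerm_support_finite (k : ℕ) (v : Fock) :
    (Function.support fun a : ℤ => currentTerm (2 * k + 1) a v).Finite := by
  obtain ⟨N, hN⟩ : ∃ N : ℕ, ∀ i ≥ N, MvPolynomial.pderiv i v = 0 := by
    refine ⟨v.vars.sup id + 1, fun i hi => MvPolynomial.pderiv_eq_zero_of_notMem_vars fun h => ?_⟩
    have := Finset.le_sup (f := id) h
    simp only [id] at this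
    omega
  refine (Set.finite_Icc (-(N + 2 * k + 2 : ℤ)) N).subset fun a ha => ?_
  by_contra hout
  apply ha
  rw [Set.mem_Icc, not_and_or, not_le, not_le] at hout
  rcases hout with h | h
  · obtain ⟨m, rfl⟩ : ∃ m : ℕ, a = Int.negSucc m := ⟨(-a - 1).toNat, by omega⟩
    obtain ⟨b, hb⟩ : ∃ b : ℕ, -Int.negSucc m - (2 * k + 1) - 1 = Int.ofNat b ∧ b < m :=
      ⟨m - (2 * k + 1), by simp only [Int.ofNat_eq_natCast]; omega, by omega⟩
    have hm : MvPolynomial.pderiv m v = 0 := hN m (by omega)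
    have hne : b ≠ m := by omega
    simp only [currentTerm, LinearMap.smul_apply, LinearMap.comp_apply]
    rw [hb.1]
    simp [boson, Derivation.leibniz, hm, MvPolynomial.pderiv_X_of_ne hne]
  · obtain ⟨m, hm⟩ : ∃ m : ℕ, -a - (2 * k + 1) - 1 = Int.negSucc m ∧ N ≤ m :=
      ⟨(a + (2 * k + 1)).toNat, by omega, by omega⟩
    simp only [currentTerm, LinearMap.smul_apply, LinearMap.comp_apply]
    rw [hm.1]
    simp [boson, hN m hm.2]

/-- The current `J_n = (1/2) ∑_{j ∈ 1/2 + ℤ} (-1)^(j + 1/2) φ_j φ_{-j-n}` for `n = 2 * k + 1`;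
on each vector only finitely many summands are nonzero. -/
noncomputable def current (k : ℕ) : Fock →ₗ[ℂ] Fock where
  toFun v := (1 / 2 : ℂ) • ∑ᶠ a : ℤ, currentTerm (2 * k + 1) a v
  map_add' v w := by
    simp only [map_add]
    rw [finsum_add_distrib (currentTerm_support_finite k v) (currentTerm_support_finite k w),
      smul_add]
  map_smul' c v := by
    simp only [map_smul, RingHom.id_apply]
    rw [← smul_finsum, smul_comm]

/-- The vectors all of whose monomials `∏ z_{m + 1/2}^{c_m}` have `∑ c_m (2 m + 1) ≤ D`. -/
noncomputable def weightLE (D : ℤ) : Submodule ℂ Fock :=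
  MvPolynomial.restrictSupport ℂ {s | (Finsupp.weight (fun m : ℕ => 2 * m + 1) s : ℤ) ≤ D}

theorem exists_mem_weightLE (v : Fock) : ∃ D : ℕ, v ∈ weightLE D := by
  refine ⟨v.support.sup (Finsupp.weight (fun m : ℕ => 2 * m + 1)), ?_⟩
  rw [weightLE, MvPolynomial.mem_restrictSupport_iff]
  intro s hs
  exact_mod_cast Finset.le_sup (f := Finsupp.weight (fun m : ℕ => 2 * m + 1)) hs

theorem eq_zero_of_mem_weightLE {D : ℤ} (hD : D < 0) {v : Fock} (hv : v ∈ weightLE D) : v = 0 := by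
  rw [weightLE, MvPolynomial.mem_restrictSupport_iff] at hv
  rw [← MvPolynomial.support_eq_empty, Finset.eq_empty_iff_forall_notMem]
  intro s hs
  have := hv hs
  simp only [Set.mem_ofPred_eq] at this
  omega

theorem weightLE_mono {D E : ℤ} (h : D ≤ E) : weightLE D ≤ weightLE E :=
  MvPolynomial.restrictSupport_mono ℂ fun _ hs => le_trans hs h

theorem boson_mem_weightLE (a : ℤ) {D : ℤ} {v : Fock} (hv : v ∈ weightLE D) :
    boson a v ∈ weightLE (D + (2 * a + 1)) := by
  rw [v.as_sum, map_sum]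
  refine Submodule.sum_mem _ fun s hs => ?_
  have hw : (Finsupp.weight (fun m : ℕ => 2 * m + 1) s : ℤ) ≤ D := by
    rw [weightLE, MvPolynomial.mem_restrictSupport_iff] at hv
    exact hv hs
  have key : ∀ (u : ℕ →₀ ℕ) (c : ℂ) (E : ℤ),
      (Finsupp.weight (fun m : ℕ => 2 * m + 1) u : ℤ) ≤ E →
      MvPolynomial.monomial u c ∈ weightLE E := by
    intro u c E hu
    rw [weightLE, MvPolynomial.mem_restrictSupport_iff]
    intro x hx
    have := MvPolynomial.support_monomial_subset hx
    rw [Finset.mem_singleton] at this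
    subst this
    exact hu
  cases a with
  | ofNat m =>
    simp only [boson, LinearMap.mulLeft_apply, MvPolynomial.X, MvPolynomial.monomial_mul]
    apply key
    rw [map_add, Finsupp.weight_single]
    simp only [smul_eq_mul, Int.ofNat_eq_natCast]
    push_cast
    linarith
  | negSucc m =>
    simp only [boson, LinearMap.smul_apply]
    change _ • (MvPolynomial.pderiv m) (MvPolynomial.monomial s _) ∈ _
    rw [MvPolynomial.pderiv_monomial]
    refine Submodule.smul_mem _ _ ?_
    by_cases h0 : s m = 0
    · simp [h0]
    · apply key
      have h1 : s - Finsupp.single m 1 + Finsupp.single m 1 = s :=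
        tsub_add_cancel_of_le (by simpa using Nat.one_le_iff_ne_zero.2 h0)
      have h2 := congrArg (Finsupp.weight (fun m : ℕ => 2 * m + 1)) h1
      rw [map_add, Finsupp.weight_single] at h2
      simp only [smul_eq_mul] at h2
      omega

theorem current_mem_weightLE (k : ℕ) {D : ℤ} {v : Fock} (hv : v ∈ weightLE D) :
    current k v ∈ weightLE (D - 2 * (2 * k + 1)) := by
  refine Submodule.smul_mem _ _ (finsum_induction (· ∈ weightLE (D - 2 * (2 * k + 1)))
    (Submodule.zero_mem _) (fun _ _ => Submodule.add_mem _) fun a => ?_)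
  refine Submodule.smul_mem _ _ ?_
  have := boson_mem_weightLE a (boson_mem_weightLE (-a - (2 * k + 1) - 1) hv)
  exact weightLE_mono (by linarith) this

theorem current_support_finite (t : ℕ → ℂ) (v : Fock) :
    (Function.support fun k : ℕ => t k • current k v).Finite := by
  obtain ⟨D, hD⟩ := exists_mem_weightLE v
  refine (Set.finite_Iic D).subset fun k hk => ?_
  by_contra h
  rw [Set.mem_Iic, not_le] at h
  apply hk
  simp only
  rw [eq_zero_of_mem_weightLE (by omega) (current_mem_weightLE k hD), smul_zero]

/-- The Hamiltonian `H(t) = ∑_{n > 0 odd} t_n J_n`, where `t k` stands for the even time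
`t_{2 k + 1}`; on each vector only finitely many summands are nonzero. -/
noncomputable def hamiltonian (t : ℕ → ℂ) : Fock →ₗ[ℂ] Fock where
  toFun v := ∑ᶠ k : ℕ, t k • current k v
  map_add' v w := by
    simp only [map_add, smul_add]
    rw [finsum_add_distrib (current_support_finite t v) (current_support_finite t w)]
  map_smul' c v := by
    simp only [map_smul, RingHom.id_apply]
    rw [smul_finsum]
    exact finsum_congr fun k => smul_comm _ _ _

theorem hamiltonian_pow_mem_weightLE (t : ℕ → ℂ) (p : ℕ) {D : ℤ} {v : Fock}
    (hv : v ∈ weightLE D) : (hamiltonian t ^ p) v ∈ weightLE (D - p) := by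
  induction p with
  | zero => simpa using hv
  | succ p ih =>
    rw [pow_succ', Module.End.mul_apply]
    refine finsum_induction (· ∈ weightLE (D - ((p + 1 : ℕ) : ℤ)))
      (Submodule.zero_mem _) (fun _ _ => Submodule.add_mem _) fun k => ?_
    refine Submodule.smul_mem _ _ (weightLE_mono ?_ (current_mem_weightLE k ih))
    push_cast
    linarith

theorem hamiltonian_pow_support_finite (t : ℕ → ℂ) (v : Fock) :
    (Function.support fun p : ℕ => (1 / (p ! : ℂ)) • (hamiltonian t ^ p) v).Finite := by
  obtain ⟨D, hD⟩ := exists_mem_weightLE v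
  refine (Set.finite_Iic D).subset fun p hp => ?_
  by_contra h
  rw [Set.mem_Iic, not_le] at h
  apply hp
  simp only
  rw [eq_zero_of_mem_weightLE (by omega) (hamiltonian_pow_mem_weightLE t p hD), smul_zero]

/-- The operator `Γ(t) = e^{H(t)} = ∑_p H(t)^p / p!` (all odd, Grassmann, times are zero);
on each vector only finitely many summands are nonzero. -/
noncomputable def Gam (t : ℕ → ℂ) : Fock →ₗ[ℂ] Fock where
  toFun v := ∑ᶠ p : ℕ, (1 / (p ! : ℂ)) • (hamiltonian t ^ p) v
  map_add' v w := by
    simp only [map_add, smul_add]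
    rw [finsum_add_distrib (hamiltonian_pow_support_finite t v)
      (hamiltonian_pow_support_finite t w)]
  map_smul' c v := by
    simp only [map_smul, RingHom.id_apply]
    rw [smul_finsum]
    exact finsum_congr fun k => smul_comm _ _ _

/-! ### Partitions with odd parts and the polynomials `C_λ`

A partition `λ` with odd parts is a multiset of odd natural numbers: `ℓ(λ) = lam.card`,
`|λ| = lam.sum`, and the multiplicity `m_i` is `lam.count i`. -/

/-- The parts `λ_1 ≥ λ_2 ≥ ⋯ ≥ λ_ℓ` in weakly decreasing order. -/
def partList (lam : Multiset ℕ) : List ℕ := lam.sort (· ≥ ·)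

/-- The number `n_{i+1}` (indices start at `0` here), where `λ_{i+1} = 2 n_{i+1} + 1`. -/
def halfPart (lam : Multiset ℕ) (i : ℕ) : ℕ := (partList lam).getD i 0 / 2

/-- The product `∏_i m_i!` of the factorials of the multiplicities. -/
def multFactorial (lam : Multiset ℕ) : ℕ := ∏ i ∈ lam.toFinset, (lam.count i)!

/-- The number `(d_λ)^2 = (-1)^{∑ n_i} ∏_i m_i!`, where `λ_i = 2 n_i + 1`. -/
noncomputable def normSquare (lam : Multiset ℕ) : ℂ :=
  (-1) ^ (lam.map fun p => p / 2).sum * (multFactorial lam : ℂ)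

/-- The basis vector `|λ⟩ = (1/d) φ_{λ_1/2} ⋯ φ_{λ_ℓ/2} |0⟩`, where `d = d_λ`. -/
noncomputable def ket (d : ℂ) (lam : Multiset ℕ) : Fock :=
  (1 / d) • ((partList lam).map fun p => (boson ((p / 2 : ℕ) : ℤ) : Module.End ℂ Fock)).prod vacuum

/-- The polynomial `C_λ(t) = ⟨0| Γ(t) |λ⟩` in the even times `t = (t_1, t_3, t_5, …)`. -/
noncomputable def polyC (d : ℂ) (lam : Multiset ℕ) (t : ℕ → ℂ) : ℂ := leftVacuum (Gam t (ket d lam))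

/-- The Hafnian of a `2k × 2k` matrix: the sum of
`A_{σ(1),σ(2)} A_{σ(3),σ(4)} ⋯ A_{σ(2k-1),σ(2k)}` over all permutations `σ` of the `2k` indices with
`σ(2i-1) < σ(2i)` for all `i` and `σ(1) < σ(3) < ⋯ < σ(2k-1)` (indices start at `0` here). -/
def hafnian {R : Type*} [CommSemiring R] {k : ℕ} (A : Matrix (Fin (2 * k)) (Fin (2 * k)) R) : R :=
  ∑ σ : Equiv.Perm (Fin (2 * k)) with
      (∀ i : Fin k, σ ⟨2 * i, by omega⟩ < σ ⟨2 * i + 1, by omega⟩) ∧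
      (∀ i j : Fin k, i < j → σ ⟨2 * i, by omega⟩ < σ ⟨2 * j, by omega⟩),
    ∏ i : Fin k, A (σ ⟨2 * i, by omega⟩) (σ ⟨2 * i + 1, by omega⟩)

/-- The symmetric matrix `1 / (n_i! n_j! (n_i + n_j + 1))`, `1 ≤ i, j ≤ 2k`, of a partition `λ` with
odd parts `λ_i = 2 n_i + 1` of length `2k`. -/
def hookMatrix (R : Type*) [Semifield R] (lam : Multiset ℕ) (k : ℕ) :
    Matrix (Fin (2 * k)) (Fin (2 * k)) R :=
  Matrix.of fun i j => 1 / (((halfPart lam i)! : R) * ((halfPart lam j)! : R) *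
    ((halfPart lam i : R) + (halfPart lam j : R) + 1))

/-! ### The process of creating and moving balls

A configuration of balls in the baskets `1, 3, 5, …` is the multiset of the positions of the
balls. -/

/-- One time step from the configuration `s`: either two balls are created in basket `1`, or one of
the balls of `s` is moved. A ball `b : s.ToType` is a basket `b.1` together with one of the
`s.count b.1` balls in this basket. -/
inductive Event (s : Multiset ℕ) : Type
  | create : Event s
  | move (b : s.ToType) : Event s

/-- The configuration after the event: `create` adds two balls in basket `1`, and `move b` moves the
ball `b` from its basket `i` to the basket `i + 2`. -/
def Event.result {s : Multiset ℕ} : Event s → Multiset ℕ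
  | .create => s + {1, 1}
  | .move b => (b.1 + 2) ::ₘ s.erase b.1

/-- The histories of `T` time steps that lead from the configuration `mu` to `lam`. -/
def History : ℕ → Multiset ℕ → Multiset ℕ → Type
  | 0, mu, lam => PLift (mu = lam)
  | T + 1, mu, lam => (e : Event mu) × History T e.result lam

/-- The number `N_{μ→λ}` of ways to create `λ` from `μ`. Each step raises the weight
by `2`, so there are `(|λ| - |μ|) / 2` steps. -/
noncomputable def numWays (mu lam : Multiset ℕ) : ℕ :=
  Nat.card (History ((lam.sum - mu.sum) / 2) mu lam)

theorem Event.finite (s : Multiset ℕ) : Finite (Event s) :=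
  Finite.of_surjective (fun o : Option s.ToType => o.elim Event.create Event.move) fun e => by
    cases e with
    | create => exact ⟨none, rfl⟩
    | move b => exact ⟨some b, rfl⟩

theorem History.finite (T : ℕ) (mu lam : Multiset ℕ) : Finite (History T mu lam) := by
  induction T generalizing mu with
  | zero => exact inferInstanceAs (Finite (PLift (mu = lam)))
  | succ T ih =>
    have := Event.finite mu
    have := fun e : Event mu => ih e.result
    exact inferInstanceAs (Finite ((e : Event mu) × History T e.result lam))

/-! Write `X m` for `φ_{m+1/2}`. On polynomials `J_1` is the second order operator `L + ½ ∂_0²`,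
where `L` is the derivation `X (m+1) ↦ X m`, `X 0 ↦ 0` (`current_zero_apply`). The functional `vev =
⟨0| e^{J_1}` is evaluated on the monomial of `λ` in two ways.

Hafnian: `J_1` lowers the weight by `2`, which gives `vev ∘ W = 2 vev ∘ J_1` for the weight
derivation `W`. Together with the recursions of `contraction`, this shows that the defect of Wick's
rule `vev (X i * v) = vev (contractWith i v)` satisfies a homogeneous relation that forces it to
vanish, by induction on `i` and on the weight (`vev_X_mul`). Iterating the rule reproduces the
expansion of the hafnian along its first row (`hafnian_succ`, `vev_prod_X`).

Counting: in the pairing of monomials, the transpose of `J_1` is one step of the ball process, with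
a move weighted by `1` and a creation by `1/2` (`pairing_current`). So `⟨0| J_1^T` on the monomial
of `λ` counts histories of `T` steps, up to `∏ m_i!` and a power of `2` fixed by the length. The
weight leaves only `T = |λ|/2`, and parity of the number of balls settles odd length. -/

/-! ### Expansion of the hafnian -/

/-- The permutation of `m + 1` indices with first value `p` whose other values are ordered like those
of `τ`. -/
def consPerm (m : ℕ) (p : Fin (m + 1)) (τ : Equiv.Perm (Fin m)) : Equiv.Perm (Fin (m + 1)) :=
  (finSuccEquiv m).trans ((Equiv.optionCongr τ).trans (finSuccEquiv' p).symm)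

@[simp] theorem consPerm_zero (m : ℕ) (p : Fin (m + 1)) (τ : Equiv.Perm (Fin m)) :
    consPerm m p τ 0 = p := by simp [consPerm]

@[simp] theorem consPerm_succ (m : ℕ) (p : Fin (m + 1)) (τ : Equiv.Perm (Fin m)) (i : Fin m) :
    consPerm m p τ i.succ = p.succAbove (τ i) := by simp [consPerm]

theorem consPerm_bijective (m : ℕ) :
    Function.Bijective fun x : Fin (m + 1) × Equiv.Perm (Fin m) => consPerm m x.1 x.2 := by
  rw [Fintype.bijective_iff_injective_and_card]
  constructor
  · rintro ⟨p, τ⟩ ⟨q, τ'⟩ h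
    have hp : p = q := by simpa using congrArg (fun σ : Equiv.Perm (Fin (m + 1)) => σ 0) h
    subst hp
    refine Prod.ext rfl (Equiv.ext fun i => ?_)
    simpa using congrArg (fun σ : Equiv.Perm (Fin (m + 1)) => σ i.succ) h
  · simp [Fintype.card_perm, Nat.factorial_succ]

theorem sum_perm_fin_succ {M : Type*} [AddCommMonoid M] (m : ℕ)
    (f : Equiv.Perm (Fin (m + 1)) → M) :
    ∑ σ, f σ = ∑ p, ∑ τ, f (consPerm m p τ) := by
  rw [← Fintype.sum_prod_type', ← (Equiv.ofBijective _ (consPerm_bijective m)).sum_comp]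
  rfl

/-- The condition on the permutations over which the hafnian sums. -/
def IsMatchingPerm {k : ℕ} (σ : Equiv.Perm (Fin (2 * k))) : Prop :=
  (∀ i : Fin k, σ ⟨2 * i, by omega⟩ < σ ⟨2 * i + 1, by omega⟩) ∧
    (∀ i j : Fin k, i < j → σ ⟨2 * i, by omega⟩ < σ ⟨2 * j, by omega⟩)

instance {k : ℕ} (σ : Equiv.Perm (Fin (2 * k))) : Decidable (IsMatchingPerm σ) :=
  inferInstanceAs (Decidable (_ ∧ _))

/-- The first value bounds from below every value at an even position, and each value at an odd
position exceeds its left neighbour, so the minimum sits at position `0`. -/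
theorem IsMatchingPerm.apply_zero {k : ℕ} {σ : Equiv.Perm (Fin (2 * (k + 1)))}
    (h : IsMatchingPerm σ) : σ 0 = 0 := by
  obtain ⟨x, hx⟩ := σ.surjective 0
  by_contra hne
  have h0 : ∀ i : Fin (k + 1), σ 0 ≤ σ ⟨2 * i, by omega⟩ := fun i => by
    rcases Fin.eq_zero_or_eq_succ i with rfl | ⟨j, rfl⟩
    · exact le_rfl
    · exact (h.2 0 j.succ (Fin.succ_pos j)).le
  rcases Nat.even_or_odd' x.1 with ⟨c, hc | hc⟩
  · have := h0 ⟨c, by omega⟩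
    rw [show (⟨2 * c, by omega⟩ : Fin (2 * (k + 1))) = x from Fin.ext hc.symm, hx] at this
    exact hne (Fin.le_zero_iff.1 this)
  · have := (h0 ⟨c, by omega⟩).trans_lt (h.1 ⟨c, by omega⟩)
    rw [show (⟨2 * c + 1, by omega⟩ : Fin (2 * (k + 1))) = x from Fin.ext hc.symm, hx] at this
    exact absurd this (Fin.not_lt_zero _)

/-- The increasing map onto the indices other than `0` and `q + 1`. -/
def skipTwo {k : ℕ} (q : Fin (2 * k + 1)) (i : Fin (2 * k)) : Fin (2 * (k + 1)) :=
  (q.succAbove i).succ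

theorem skipTwo_strictMono {k : ℕ} (q : Fin (2 * k + 1)) : StrictMono (skipTwo q) :=
  (Fin.strictMono_succ).comp (Fin.strictMono_succAbove q)

/-- The permutation with first values `0` and `q + 1` whose other values are ordered like those of
`τ`. -/
def consPairPerm {k : ℕ} (q : Fin (2 * k + 1)) (τ : Equiv.Perm (Fin (2 * k))) :
    Equiv.Perm (Fin (2 * (k + 1))) :=
  consPerm (2 * k + 1) 0 (consPerm (2 * k) q τ)

theorem consPairPerm_zero {k : ℕ} (q : Fin (2 * k + 1)) (τ : Equiv.Perm (Fin (2 * k)))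
    (h : 0 < 2 * (k + 1)) : consPairPerm q τ ⟨0, h⟩ = 0 := consPerm_zero _ _ _

theorem consPairPerm_one {k : ℕ} (q : Fin (2 * k + 1)) (τ : Equiv.Perm (Fin (2 * k)))
    (h : 1 < 2 * (k + 1)) : consPairPerm q τ ⟨1, h⟩ = q.succ := by
  have h1 := consPerm_succ (2 * k + 1) 0 (consPerm (2 * k) q τ) 0
  rw [consPerm_zero, Fin.zero_succAbove] at h1
  exact h1

theorem consPairPerm_add_two {k : ℕ} (q : Fin (2 * k + 1)) (τ : Equiv.Perm (Fin (2 * k)))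
    (i : ℕ) (hi : i < 2 * k) (h : i + 2 < 2 * (k + 1)) :
    consPairPerm q τ ⟨i + 2, h⟩ = skipTwo q (τ ⟨i, hi⟩) := by
  have h1 := consPerm_succ (2 * k + 1) 0 (consPerm (2 * k) q τ) (Fin.succ ⟨i, hi⟩)
  rw [consPerm_succ, Fin.zero_succAbove] at h1
  exact h1

/-- All conditions that involve the new first pair hold automatically because `0` is minimal; the
others transfer since `skipTwo q` is increasing. -/
theorem isMatchingPerm_consPairPerm {k : ℕ} (q : Fin (2 * k + 1)) (τ : Equiv.Perm (Fin (2 * k))) :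
    IsMatchingPerm (consPairPerm q τ) ↔ IsMatchingPerm τ := by
  have he : ∀ i : Fin k, consPairPerm q τ ⟨2 * (i.succ : Fin (k + 1)), by omega⟩ =
      skipTwo q (τ ⟨2 * i, by omega⟩) := fun i => consPairPerm_add_two q τ (2 * i) _ _
  have ho : ∀ i : Fin k, consPairPerm q τ ⟨2 * (i.succ : Fin (k + 1)) + 1, by omega⟩ =
      skipTwo q (τ ⟨2 * i + 1, by omega⟩) := fun i => consPairPerm_add_two q τ (2 * i + 1) _ _
  unfold IsMatchingPerm
  rw [Fin.forall_fin_succ]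
  simp only [Fin.forall_fin_succ (P := fun i : Fin (k + 1) => ∀ j : Fin (k + 1), _), he, ho]
  simp only [Fin.forall_fin_succ, he, (skipTwo_strictMono q).lt_iff_lt, Fin.succ_lt_succ_iff]
  have h0 : ∀ h, consPairPerm q τ ⟨2 * ((0 : Fin (k + 1)) : ℕ), h⟩ = 0 :=
    fun h => consPairPerm_zero q τ h
  have h1 : ∀ h, consPairPerm q τ ⟨2 * ((0 : Fin (k + 1)) : ℕ) + 1, h⟩ = q.succ :=
    fun h => consPairPerm_one q τ h
  simp only [h0, h1]
  constructor
  · rintro ⟨⟨-, ha⟩, -, hb⟩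
    exact ⟨ha, fun i j => (hb i).2 j⟩
  · rintro ⟨ha, hb⟩
    refine ⟨⟨Fin.succ_pos _, ha⟩, ⟨fun h => absurd h (lt_irrefl _), fun i _ => Fin.succ_pos _⟩,
      fun i => ⟨fun h => absurd h (Fin.not_lt_zero _), hb i⟩⟩

/-- Expansion of the hafnian along the first row. -/
theorem hafnian_succ {R : Type*} [CommSemiring R] {k : ℕ}
    (A : Matrix (Fin (2 * (k + 1))) (Fin (2 * (k + 1))) R) :
    hafnian A = ∑ q : Fin (2 * k + 1), A 0 q.succ * hafnian (A.submatrix (skipTwo q) (skipTwo q)) := by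
  have hdef : ∀ {l : ℕ} (B : Matrix (Fin (2 * l)) (Fin (2 * l)) R), hafnian B =
      ∑ σ : Equiv.Perm (Fin (2 * l)), if IsMatchingPerm σ then
        ∏ i : Fin l, B (σ ⟨2 * i, by omega⟩) (σ ⟨2 * i + 1, by omega⟩) else 0 := by
    intro l B
    rw [hafnian, Finset.sum_filter]
    refine Finset.sum_congr rfl fun σ _ => if_congr Iff.rfl rfl rfl
  rw [hdef A]
  refine (sum_perm_fin_succ (2 * k + 1) _).trans ?_
  -- A matching permutation has first value `0`; its second value `q + 1` remains free.
  rw [Finset.sum_eq_single 0]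
  · refine (sum_perm_fin_succ (2 * k) _).trans (Finset.sum_congr rfl fun q _ => ?_)
    rw [hdef, Finset.mul_sum]
    refine Finset.sum_congr rfl fun τ _ => ?_
    rw [mul_ite, mul_zero]
    refine if_congr (isMatchingPerm_consPairPerm q τ) ?_ rfl
    rw [Fin.prod_univ_succ]
    refine congrArg₂ (· * ·) ?_ (Finset.prod_congr rfl fun i _ => ?_)
    · exact congrArg₂ A (consPairPerm_zero q τ _) (consPairPerm_one q τ _)
    · exact congrArg₂ A (consPairPerm_add_two q τ (2 * i) _ _)
        (consPairPerm_add_two q τ (2 * i + 1) _ _)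
  · intro p _ hp
    refine Finset.sum_eq_zero fun τ _ => if_neg fun h => hp ?_
    have := h.apply_zero
    exact (consPerm_zero _ p τ).symm.trans this
  · simp

theorem map_hafnian {R S : Type*} [CommSemiring R] [CommSemiring S] (f : R →+* S) {k : ℕ}
    (A : Matrix (Fin (2 * k)) (Fin (2 * k)) R) : f (hafnian A) = hafnian (A.map f) := by
  simp [hafnian, map_sum, map_prod]

theorem hafnian_zero {R : Type*} [CommSemiring R] (A : Matrix (Fin (2 * 0)) (Fin (2 * 0)) R) :
    hafnian A = 1 := by
  rw [hafnian, Finset.filter_true_of_mem fun σ _ => ⟨fun i => i.elim0, fun i => i.elim0⟩]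
  simp

open MvPolynomial

/-! ### The current `J_1` as a second order differential operator -/

/-- The derivation with `X 0 ↦ 0` and `X (m + 1) ↦ X m`. -/
noncomputable def lowering : Derivation ℂ Fock Fock :=
  mkDerivation ℂ fun m => m.casesOn 0 fun m => X m

@[simp] theorem lowering_X_zero : lowering (X 0) = 0 := mkDerivation_X _ _ _

@[simp] theorem lowering_X_succ (m : ℕ) : lowering (X (m + 1)) = X m := mkDerivation_X _ _ _

theorem exists_pderiv_eq_zero (v : Fock) : ∃ N : ℕ, ∀ i ≥ N, pderiv i v = 0 ∧ i ∉ v.vars := by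
  have h : ∀ i ≥ v.vars.sup id + 1, i ∉ v.vars := fun i hi h => by
    have := Finset.le_sup (f := id) h
    simp only [id] at this
    omega
  exact ⟨_, fun i hi => ⟨pderiv_eq_zero_of_notMem_vars (h i hi), h i hi⟩⟩

theorem derivation_sum_apply {ι : Type*} (s : Finset ι) (δ : ι → Derivation ℂ Fock Fock) (v : Fock) :
    (∑ m ∈ s, δ m) v = ∑ m ∈ s, δ m v := by
  classical
  induction s using Finset.induction_on with
  | empty => simp
  | insert a s ha ih => rw [Finset.sum_insert ha, Finset.sum_insert ha, Derivation.add_apply, ih]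

/-- A finite sum of derivations is a derivation, and two derivations agree at `v` once they agree on
the variables of `v`; the cutoff `N` lies beyond all of these. -/
theorem sum_X_mul_pderiv_eq_lowering {v : Fock} {N : ℕ} (hN : ∀ i ≥ N, i ∉ v.vars) :
    ∑ m ∈ Finset.range N, X m * pderiv (m + 1) v = lowering v := by
  have h : (∑ m ∈ Finset.range N, (X m : Fock) • (pderiv (m + 1) : Derivation ℂ Fock Fock)) v =
      lowering v := by
    refine derivation_eq_of_forall_mem_vars fun i hi => ?_
    have hiN : i < N := not_le.1 fun h => hN i h hi
    simp only [derivation_sum_apply, Derivation.smul_apply, smul_eq_mul]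
    cases i with
    | zero => simp
    | succ i =>
      rw [Finset.sum_eq_single i]
      · simp
      · intro b _ hb
        rw [pderiv_X_of_ne (by omega), mul_zero]
      · intro h
        exact absurd (Finset.mem_range.2 (by omega)) h
  simpa only [derivation_sum_apply, Derivation.smul_apply, smul_eq_mul] using h

theorem boson_ofNat (m : ℕ) (v : Fock) : boson (Int.ofNat m) v = X m * v := rfl

theorem boson_negSucc (m : ℕ) (v : Fock) :
    boson (Int.negSucc m) v = (-1 : ℂ) ^ m • pderiv m v := rfl

theorem currentTerm_one_ofNat (m : ℕ) (v : Fock) :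
    currentTerm 1 (Int.ofNat m) v = X m * pderiv (m + 1) v := by
  have h : -(Int.ofNat m) - 1 - 1 = Int.negSucc (m + 1) := by
    simp only [Int.ofNat_eq_natCast]; omega
  have hs : (-1 : ℂ) ^ ((m : ℤ) + 1) = (-1) ^ (m + 1) := by exact_mod_cast zpow_natCast (-1 : ℂ) (m + 1)
  simp only [currentTerm, LinearMap.smul_apply, LinearMap.comp_apply]
  rw [h, boson_ofNat, boson_negSucc, Int.ofNat_eq_natCast, hs, mul_smul_comm, smul_smul, ← mul_pow]
  simp

theorem currentTerm_one_negSucc (m : ℕ) (v : Fock) :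
    currentTerm 1 (Int.negSucc (m + 1)) v = X m * pderiv (m + 1) v := by
  have h : -(Int.negSucc (m + 1)) - 1 - 1 = Int.ofNat m := by
    simp only [Int.ofNat_eq_natCast]; omega
  have hs : (-1 : ℂ) ^ (Int.negSucc (m + 1) + 1) = (-1) ^ (m + 1) := by
    rw [show Int.negSucc (m + 1) + 1 = -((m + 1 : ℕ) : ℤ) by omega, zpow_neg, zpow_natCast,
      ← inv_pow]
    norm_num
  simp only [currentTerm, LinearMap.smul_apply, LinearMap.comp_apply]
  rw [h, hs, boson_ofNat, boson_negSucc, smul_smul, ← mul_pow]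
  simp [Derivation.leibniz]

theorem currentTerm_one_negSucc_zero (v : Fock) :
    currentTerm 1 (Int.negSucc 0) v = pderiv 0 (pderiv 0 v) := by
  have h : -(Int.negSucc 0) - 1 - 1 = Int.negSucc 0 := rfl
  have h' : Int.negSucc 0 + 1 = 0 := rfl
  simp only [currentTerm, LinearMap.smul_apply, LinearMap.comp_apply]
  rw [h, h']
  simp [boson]

theorem finsum_int_eq {M : Type*} [AddCommMonoid M] {f : ℤ → M}
    (hf : (Function.support f).Finite) :
    ∑ᶠ a, f a = ∑ᶠ m : ℕ, f (Int.ofNat m) + ∑ᶠ m : ℕ, f (Int.negSucc m) := by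
  rw [← finsum_mem_range (f := f) (g := Int.ofNat) (fun _ _ => Int.ofNat.inj),
    ← finsum_mem_range (f := f) (g := Int.negSucc) (fun _ _ => Int.negSucc.inj),
    ← finsum_mem_union' _ (hf.inter_of_right _) (hf.inter_of_right _)]
  · rw [show Set.range Int.ofNat ∪ Set.range Int.negSucc = Set.univ from ?_, finsum_mem_univ]
    ext a
    cases a <;> simp
  · rw [Set.disjoint_left]
    rintro _ ⟨a, rfl⟩ ⟨b, hb⟩
    cases hb

/-- The summands for `j` and `-j-1` coincide: each `X m ∂_{m+1}` occurs twice, which cancels the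
prefactor `1/2`. Only `j = -1/2` is its own partner, and it leaves `½ ∂_0²`. -/
theorem current_zero_apply (v : Fock) :
    current 0 v = lowering v + (1 / 2 : ℂ) • pderiv 0 (pderiv 0 v) := by
  obtain ⟨N, hN⟩ := exists_pderiv_eq_zero v
  have hfin := currentTerm_support_finite 0 v
  simp only [Nat.cast_zero, mul_zero, zero_add] at hfin
  change (1 / 2 : ℂ) • ∑ᶠ a : ℤ, currentTerm (2 * (0 : ℕ) + 1) a v = _
  simp only [Nat.cast_zero, mul_zero, zero_add]
  rw [finsum_int_eq hfin]
  have h1 : ∑ᶠ m : ℕ, currentTerm 1 (Int.ofNat m) v = lowering v := by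
    rw [finsum_eq_sum_of_support_subset (s := Finset.range N),
      ← sum_X_mul_pderiv_eq_lowering fun i hi => (hN i hi).2]
    · exact Finset.sum_congr rfl fun m _ => currentTerm_one_ofNat m v
    · intro m hm
      rw [Function.mem_support, currentTerm_one_ofNat] at hm
      by_contra h
      simp only [Finset.coe_range, Set.mem_Iio, not_lt] at h
      exact hm (by rw [(hN (m + 1) (by omega)).1, mul_zero])
  have h2 : ∑ᶠ m : ℕ, currentTerm 1 (Int.negSucc m) v =
      lowering v + pderiv 0 (pderiv 0 v) := by
    rw [finsum_eq_sum_of_support_subset (s := Finset.range (N + 1)),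
      ← sum_X_mul_pderiv_eq_lowering fun i hi => (hN i hi).2, Finset.sum_range_succ',
      currentTerm_one_negSucc_zero]
    · congr 1
      exact Finset.sum_congr rfl fun m _ => currentTerm_one_negSucc m v
    · intro m hm
      by_contra h
      simp only [Finset.coe_range, Set.mem_Iio, not_lt] at h
      obtain ⟨m, rfl⟩ : ∃ l, m = l + 1 := ⟨m - 1, by omega⟩
      rw [Function.mem_support, currentTerm_one_negSucc] at hm
      exact hm (by rw [(hN (m + 1) (by omega)).1, mul_zero])
  rw [h1, h2, ← add_assoc, smul_add, ← two_smul ℂ, smul_smul]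
  norm_num

theorem hamiltonian_single_apply (v : Fock) : hamiltonian (Pi.single 0 1) v = current 0 v := by
  change ∑ᶠ k : ℕ, (Pi.single 0 1 : ℕ → ℂ) k • current k v = _
  rw [finsum_eq_single _ 0]
  · simp
  · intro k hk
    simp [hk]

/-! ### The functional `⟨0| e^{J_1}` -/

theorem leftVacuum_apply (v : Fock) : leftVacuum v = aeval (fun _ => (0 : ℂ)) v := rfl

@[simp] theorem leftVacuum_mul (v w : Fock) : leftVacuum (v * w) = leftVacuum v * leftVacuum w := by
  simp [leftVacuum_apply]

@[simp] theorem leftVacuum_X (m : ℕ) : leftVacuum (X m) = 0 := by simp [leftVacuum_apply]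

@[simp] theorem leftVacuum_one : leftVacuum 1 = 1 := by simp [leftVacuum_apply]

theorem leftVacuum_derivation {δ : Derivation ℂ Fock Fock} (h : ∀ m, leftVacuum (δ (X m)) = 0)
    (v : Fock) : leftVacuum (δ v) = 0 := by
  induction v using MvPolynomial.induction_on with
  | C a => simp
  | add p q hp hq => simp [hp, hq]
  | mul_X p m hp => simp [Derivation.leibniz, h]

theorem leftVacuum_lowering (v : Fock) : leftVacuum (lowering v) = 0 :=
  leftVacuum_derivation (fun m => by cases m <;> simp) v

/-- The functional `⟨0| Γ(1, 0, 0, …)`. -/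
noncomputable def vev : Fock →ₗ[ℂ] ℂ := leftVacuum ∘ₗ Gam (Pi.single 0 1)

theorem hamiltonian_pow_single (p : ℕ) :
    hamiltonian (Pi.single 0 1) ^ p = (current 0 : Module.End ℂ Fock) ^ p := by
  rw [show hamiltonian (Pi.single 0 1) = current 0 from LinearMap.ext hamiltonian_single_apply]

theorem vev_eq_finsum (v : Fock) :
    vev v = ∑ᶠ p : ℕ, (1 / (p ! : ℂ)) * leftVacuum (((current 0 : Module.End ℂ Fock) ^ p) v) := by
  change leftVacuum (∑ᶠ p : ℕ, (1 / (p ! : ℂ)) • (hamiltonian (Pi.single 0 1) ^ p) v) = _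
  rw [map_finsum _ (hamiltonian_pow_support_finite _ v)]
  simp only [map_smul, smul_eq_mul, hamiltonian_pow_single]

theorem vev_support_finite (v : Fock) : (Function.support fun p : ℕ =>
    (1 / (p ! : ℂ)) * leftVacuum (((current 0 : Module.End ℂ Fock) ^ p) v)).Finite := by
  refine (hamiltonian_pow_support_finite (Pi.single 0 1) v).subset fun p hp h => hp ?_
  have := congrArg leftVacuum h
  simpa only [map_smul, smul_eq_mul, hamiltonian_pow_single, map_zero] using this

/-! ### The weight grading and commutators with `J_1` -/

/-- The derivation with `X m ↦ (2 m + 1) X m`, which measures the weight. -/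
noncomputable def weightDerivation : Derivation ℂ Fock Fock :=
  mkDerivation ℂ fun m => ((2 * m + 1 : ℕ) : ℂ) • X m

@[simp] theorem weightDerivation_X (m : ℕ) :
    weightDerivation (X m) = ((2 * m + 1 : ℕ) : ℂ) • X m := mkDerivation_X _ _ _

theorem weightDerivation_monomial (s : ℕ →₀ ℕ) (c : ℂ) :
    weightDerivation (monomial s c) =
      ((Finsupp.weight (fun m : ℕ => 2 * m + 1) s : ℕ) : ℂ) • monomial s c := by
  rw [weightDerivation, mkDerivation_monomial, Finsupp.weight_apply, Finsupp.sum, Finsupp.sum,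
    Nat.cast_sum, Finset.sum_smul, Finset.smul_sum]
  refine Finset.sum_congr rfl fun m hm => ?_
  have h1 : s - Finsupp.single m 1 + Finsupp.single m 1 = s :=
    tsub_add_cancel_of_le (by simpa using Nat.one_le_iff_ne_zero.2 (Finsupp.mem_support_iff.1 hm))
  rw [smul_eq_mul, X, mul_smul_comm, monomial_mul, h1, smul_monomial, smul_monomial,
    smul_monomial]
  congr 1
  simp only [smul_eq_mul, Nat.cast_mul]
  ring

theorem pderiv_comm (i j : ℕ) (v : Fock) : pderiv i (pderiv j v) = pderiv j (pderiv i v) := by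
  have h : ⁅(pderiv i : Derivation ℂ Fock Fock), (pderiv j : Derivation ℂ Fock Fock)⁆ = 0 := by
    refine derivation_ext fun m => ?_
    rw [Derivation.commutator_apply, pderiv_X, pderiv_X]
    simp [Pi.single_apply, apply_ite]
  have := congrArg (fun δ : Derivation ℂ Fock Fock => δ v) h
  simpa [Derivation.commutator_apply, sub_eq_zero] using this

/-- The commutator of two derivations is a derivation, so the commutation relations below need
checking on variables only. -/
theorem commutator_apply_eq {δ ε η : Derivation ℂ Fock Fock}
    (h : ∀ m, δ (ε (X m)) = ε (δ (X m)) + η (X m)) (v : Fock) :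
    δ (ε v) = ε (δ v) + η v := by
  have h' : ⁅δ, ε⁆ = η := derivation_ext fun m => by
    rw [Derivation.commutator_apply, h, add_sub_cancel_left]
  rw [← h', Derivation.commutator_apply]
  abel

theorem pderiv_lowering (m : ℕ) (v : Fock) :
    pderiv m (lowering v) = lowering (pderiv m v) + pderiv (m + 1) v := by
  refine commutator_apply_eq (fun l => ?_) v
  cases l with
  | zero => simp [pderiv_X, Pi.single_apply, apply_ite]
  | succ l => simp [pderiv_X, Pi.single_apply, apply_ite]

/-- Only `L` fails to commute with `∂_m`. On the dual side the extra term is a ball passing from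
basket `2m+1` to `2m+3`. -/
theorem pderiv_current (m : ℕ) (v : Fock) :
    pderiv m (current 0 v) = current 0 (pderiv m v) + pderiv (m + 1) v := by
  rw [current_zero_apply, current_zero_apply, map_add, pderiv_lowering, Derivation.map_smul,
    pderiv_comm m 0, pderiv_comm m 0]
  abel

theorem current_weightDerivation (v : Fock) :
    current 0 (weightDerivation v) = weightDerivation (current 0 v) + (2 : ℂ) • current 0 v := by
  have h0 : ∀ v : Fock, pderiv 0 (weightDerivation v) = weightDerivation (pderiv 0 v) + pderiv 0 v :=
    fun v => commutator_apply_eq (fun l => by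
      rcases eq_or_ne l 0 with rfl | hl
      · simp
      · simp [pderiv_X_of_ne hl]) v
  have h1 : lowering (weightDerivation v) =
      weightDerivation (lowering v) + ((2 : ℂ) • lowering) v := by
    refine commutator_apply_eq (fun l => ?_) v
    cases l with
    | zero => simp
    | succ l =>
      simp only [weightDerivation_X, Derivation.map_smul, lowering_X_succ, Derivation.smul_apply,
        ← add_smul]
      congr 1
      push_cast
      ring
  rw [current_zero_apply, current_zero_apply, h0, map_add, h0, h1, map_add, Derivation.map_smul,
    Derivation.smul_apply]
  module

theorem current_pow_weightDerivation (p : ℕ) (v : Fock) :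
    ((current 0 : Module.End ℂ Fock) ^ p) (weightDerivation v) =
      weightDerivation (((current 0 : Module.End ℂ Fock) ^ p) v) +
        (2 * p : ℂ) • ((current 0 : Module.End ℂ Fock) ^ p) v := by
  induction p with
  | zero => simp
  | succ p ih =>
    rw [pow_succ', Module.End.mul_apply, ih, map_add, current_weightDerivation, map_smul,
      Module.End.mul_apply]
    push_cast
    module

theorem leftVacuum_weightDerivation (v : Fock) : leftVacuum (weightDerivation v) = 0 :=
  leftVacuum_derivation (fun m => by simp) v

theorem finsum_nat_succ {M : Type*} [AddCommMonoid M] {f : ℕ → M}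
    (hf : (Function.support f).Finite) (h0 : f 0 = 0) : ∑ᶠ n, f n = ∑ᶠ n, f (n + 1) := by
  obtain ⟨M, hM⟩ := hf.bddAbove
  rw [finsum_eq_sum_of_support_subset f (s := Finset.range (M + 1)),
    finsum_eq_sum_of_support_subset (s := Finset.range M), Finset.sum_range_succ', h0, add_zero]
  · intro n hn
    have := hM (show n + 1 ∈ Function.support f from hn)
    simp only [Finset.coe_range, Set.mem_Iio]
    omega
  · intro n hn
    have := hM hn
    simp only [Finset.coe_range, Set.mem_Iio]
    omega

/-- In `J^p W = W J^p + 2p J^p` the first term is killed by `⟨0|`, and `2p/p! = 2/(p-1)!` shifts the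
exponential series by one index. -/
theorem vev_weightDerivation (v : Fock) : vev (weightDerivation v) = 2 * vev (current 0 v) := by
  have hfin := vev_support_finite (weightDerivation v)
  rw [vev_eq_finsum, vev_eq_finsum, finsum_nat_succ hfin
    (by simp [leftVacuum_weightDerivation]), mul_finsum]
  · refine finsum_congr fun p => ?_
    rw [current_pow_weightDerivation, map_add, leftVacuum_weightDerivation, zero_add, pow_succ,
      Module.End.mul_apply, map_smul, smul_eq_mul, Nat.factorial_succ]
    have := Nat.factorial_ne_zero p
    have h1 : ((p : ℂ) + 1) ≠ 0 := Nat.cast_add_one_ne_zero p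
    push_cast
    field_simp

/-! ### Wick's theorem -/

/-- The contraction `⟨0| e^{J_1} φ_{i + 1/2} φ_{j + 1/2} |0⟩`. -/
noncomputable def contraction (i j : ℕ) : ℂ := 1 / ((i ! : ℂ) * (j ! : ℂ) * ((i : ℂ) + (j : ℂ) + 1))

/-- The derivation with `X j ↦ contraction i j`. -/
noncomputable def contractWith (i : ℕ) : Derivation ℂ Fock Fock :=
  mkDerivation ℂ fun j => C (contraction i j)

@[simp] theorem contractWith_X (i j : ℕ) : contractWith i (X j) = C (contraction i j) :=
  mkDerivation_X _ _ _

theorem contraction_zero_zero : contraction 0 0 = 1 := by simp [contraction]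

/-- This and the next two recursions are what `vev_weightDerivation` predicts for `X i * X j`: its
weight is `2(i+j+1)`, and `J_1` lowers the index of one of the two factors. -/
theorem contraction_zero_succ (j : ℕ) :
    ((j : ℂ) + 2) * contraction 0 (j + 1) = contraction 0 j := by
  have h1 : (j ! : ℂ) ≠ 0 := by exact_mod_cast Nat.factorial_ne_zero j
  have h2 : (j : ℂ) + 1 ≠ 0 := Nat.cast_add_one_ne_zero j
  have h3 : (j : ℂ) + 2 ≠ 0 := by exact_mod_cast Nat.succ_ne_zero (j + 1)
  simp only [contraction, Nat.factorial_succ]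
  push_cast
  rw [show (0 : ℂ) + (j + 1) + 1 = j + 2 by ring, zero_add]
  field_simp

theorem contraction_succ_zero (i : ℕ) :
    ((i : ℂ) + 2) * contraction (i + 1) 0 = contraction i 0 := by
  have h := contraction_zero_succ i
  simp only [contraction] at *
  push_cast at *
  simp only [zero_add, add_zero, mul_one, one_mul, Nat.factorial_zero, Nat.cast_one] at *
  exact h

theorem contraction_succ_succ (i j : ℕ) :
    ((i : ℂ) + j + 3) * contraction (i + 1) (j + 1) =
      contraction i (j + 1) + contraction (i + 1) j := by
  have h1 : (j ! : ℂ) ≠ 0 := by exact_mod_cast Nat.factorial_ne_zero j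
  have h2 : (i ! : ℂ) ≠ 0 := by exact_mod_cast Nat.factorial_ne_zero i
  have h3 : (j : ℂ) + 1 ≠ 0 := Nat.cast_add_one_ne_zero j
  have h4 : (i : ℂ) + 1 ≠ 0 := Nat.cast_add_one_ne_zero i
  have h5 : (i : ℂ) + j + 3 ≠ 0 := by exact_mod_cast Nat.succ_ne_zero (i + j + 2)
  have h6 : (i : ℂ) + j + 2 ≠ 0 := by exact_mod_cast Nat.succ_ne_zero (i + j + 1)
  simp only [contraction, Nat.factorial_succ]
  push_cast
  rw [show (i : ℂ) + 1 + (j + 1) + 1 = i + j + 3 by ring,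
    show (i : ℂ) + (j + 1) + 1 = i + j + 2 by ring, show (i : ℂ) + 1 + j + 1 = i + j + 2 by ring]
  field_simp
  ring

theorem current_X_zero_mul (v : Fock) : current 0 (X 0 * v) = X 0 * current 0 v + pderiv 0 v := by
  simp only [current_zero_apply, Derivation.leibniz, map_add, lowering_X_zero, pderiv_X_self,
    smul_eq_mul, mul_zero, mul_one, add_zero, mul_add, mul_smul_comm]
  module

theorem current_X_succ_mul (i : ℕ) (v : Fock) :
    current 0 (X (i + 1) * v) = X (i + 1) * current 0 v + X i * v := by
  have h : (pderiv 0 (X (i + 1)) : Fock) = 0 := pderiv_X_of_ne (by omega)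
  simp only [current_zero_apply, Derivation.leibniz, lowering_X_succ, h,
    smul_eq_mul, mul_zero, add_zero, mul_add, mul_smul_comm]
  ring

theorem pderiv_contractWith (i m : ℕ) (v : Fock) :
    contractWith i (pderiv m v) = pderiv m (contractWith i v) := by
  have := commutator_apply_eq (δ := contractWith i) (ε := pderiv m) (η := 0) (fun l => by
    simp [pderiv_X, Pi.single_apply, apply_ite]) v
  simpa using this

/-- The commutator of `contractWith i` with `J_1`. -/
noncomputable def contractShift (i : ℕ) : Derivation ℂ Fock Fock :=
  mkDerivation ℂ fun j => j.casesOn 0 fun j => C (contraction i j)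

@[simp] theorem contractShift_X_zero (i : ℕ) : contractShift i (X 0) = 0 := mkDerivation_X _ _ _

@[simp] theorem contractShift_X_succ (i j : ℕ) :
    contractShift i (X (j + 1)) = C (contraction i j) := mkDerivation_X _ _ _

/-- `contractWith i` takes constant values on variables, hence commutes with `∂_0`; only the
commutator with `L` survives. -/
theorem contractWith_current (i : ℕ) (v : Fock) :
    contractWith i (current 0 v) = current 0 (contractWith i v) + contractShift i v := by
  have h : contractWith i (lowering v) = lowering (contractWith i v) + contractShift i v :=
    commutator_apply_eq (fun l => by cases l <;> simp) v
  rw [current_zero_apply, current_zero_apply, map_add, h, Derivation.map_smul,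
    pderiv_contractWith, pderiv_contractWith]
  abel

/-- The commutator of `contractWith i` with `weightDerivation`. -/
noncomputable def contractWeight (i : ℕ) : Derivation ℂ Fock Fock :=
  mkDerivation ℂ fun j => ((2 * j + 1 : ℕ) : ℂ) • C (contraction i j)

theorem contractWith_weightDerivation (i : ℕ) (v : Fock) :
    contractWith i (weightDerivation v) = weightDerivation (contractWith i v) + contractWeight i v :=
  commutator_apply_eq (fun l => by simp [contractWeight]) v

/-- On variables this is the contraction recursion; `∂_0` stands in for the missing `contractWith
(-1)`. -/
theorem contractWeight_zero (v : Fock) :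
    contractWeight 0 v + contractWith 0 v = (2 : ℂ) • contractShift 0 v + (2 : ℂ) • pderiv 0 v := by
  have h : contractWeight 0 + contractWith 0 =
      (2 : ℂ) • contractShift 0 + (2 : ℂ) • (pderiv 0 : Derivation ℂ Fock Fock) := by
    refine derivation_ext fun l => ?_
    cases l with
    | zero =>
      simp [contractWeight, contraction_zero_zero, ← two_smul ℂ (1 : Fock)]
    | succ l =>
      rw [Derivation.add_apply, Derivation.add_apply, Derivation.smul_apply, Derivation.smul_apply,
        pderiv_X_of_ne (by omega), contractWith_X, contractShift_X_succ, contractWeight,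
        mkDerivation_X]
      simp only [smul_zero, add_zero, smul_eq_C_mul, ← C_mul, ← C_add]
      congr 1
      push_cast
      linear_combination (2 : ℂ) * contraction_zero_succ l
  exact congrArg (fun δ : Derivation ℂ Fock Fock => δ v) h

theorem contractWeight_succ (i : ℕ) (v : Fock) :
    contractWeight (i + 1) v + (2 * i + 3 : ℂ) • contractWith (i + 1) v =
      (2 : ℂ) • contractShift (i + 1) v + (2 : ℂ) • contractWith i v := by
  have h : contractWeight (i + 1) + (2 * i + 3 : ℂ) • contractWith (i + 1) =
      (2 : ℂ) • contractShift (i + 1) + (2 : ℂ) • contractWith i := by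
    refine derivation_ext fun l => ?_
    cases l with
    | zero =>
      simp only [Derivation.add_apply, Derivation.smul_apply, contractWith_X, contractWeight,
        contractShift_X_zero, mkDerivation_X, smul_zero, zero_add,
        smul_eq_C_mul, ← C_mul, ← C_add]
      congr 1
      push_cast
      linear_combination (2 : ℂ) * contraction_succ_zero i
    | succ l =>
      simp only [Derivation.add_apply, Derivation.smul_apply, contractWith_X, contractWeight,
        contractShift_X_succ, mkDerivation_X, smul_eq_C_mul, ← C_mul, ← C_add]
      congr 1
      push_cast
      linear_combination (2 : ℂ) * contraction_succ_succ i l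
  exact congrArg (fun δ : Derivation ℂ Fock Fock => δ v) h

/-- The defect `⟨0| e^{J_1} (X i v - contractWith i v)` of Wick's theorem. -/
noncomputable def wickDefect (i : ℕ) : Fock →ₗ[ℂ] ℂ :=
  vev ∘ₗ LinearMap.mulLeft ℂ (X i) - vev ∘ₗ (contractWith i).toLinearMap

theorem wickDefect_apply (i : ℕ) (v : Fock) :
    wickDefect i v = vev (X i * v) - vev (contractWith i v) := rfl

theorem vev_X_mul_weightDerivation (i : ℕ) (v : Fock) :
    vev (X i * weightDerivation v) = 2 * vev (current 0 (X i * v)) - (2 * i + 1) * vev (X i * v) := by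
  rw [← vev_weightDerivation, Derivation.leibniz, map_add, weightDerivation_X, smul_eq_mul,
    smul_eq_mul, mul_smul_comm, map_smul, smul_eq_mul, mul_comm v]
  push_cast
  ring

theorem vev_contractWith_weightDerivation (i : ℕ) (v : Fock) :
    vev (contractWith i (weightDerivation v)) =
      2 * vev (contractWith i (current 0 v)) - 2 * vev (contractShift i v) +
        vev (contractWeight i v) := by
  rw [contractWith_weightDerivation, contractWith_current, map_add, map_add, vev_weightDerivation]
  ring

/-- The `∂_0 v` produced by moving `J_1` past `X 0` cancels the one in `contractWeight_zero`, so the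
relation is homogeneous. -/
theorem wickDefect_zero_weightDerivation (v : Fock) :
    wickDefect 0 (weightDerivation v) + wickDefect 0 v = 2 * wickDefect 0 (current 0 v) := by
  have h := congrArg vev (contractWeight_zero v)
  simp only [map_add, map_smul, smul_eq_mul] at h
  simp only [wickDefect_apply, vev_X_mul_weightDerivation, vev_contractWith_weightDerivation,
    current_X_zero_mul, map_add, Nat.cast_zero]
  linear_combination -h

/-- Here the leftover terms `X i * v` and `contractWith i v` assemble into the defect of index `i`,
which the induction on `i` removes. -/
theorem wickDefect_succ_weightDerivation (i : ℕ) (v : Fock) :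
    wickDefect (i + 1) (weightDerivation v) + (2 * i + 3) * wickDefect (i + 1) v =
      2 * wickDefect (i + 1) (current 0 v) + 2 * wickDefect i v := by
  have h := congrArg vev (contractWeight_succ i v)
  simp only [map_add, map_smul, smul_eq_mul] at h
  simp only [wickDefect_apply, vev_X_mul_weightDerivation, vev_contractWith_weightDerivation,
    current_X_succ_mul, map_add, Nat.cast_add, Nat.cast_one]
  linear_combination -h

/-- A functional `R` with `R ∘ (weight + c) = 2 R ∘ J_1` for some `c > 0` vanishes. -/
theorem eq_zero_of_weightDerivation (R : Fock →ₗ[ℂ] ℂ) (c : ℕ) (hc : 0 < c)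
    (h : ∀ v, R (weightDerivation v) + c * R v = 2 * R (current 0 v)) (v : Fock) : R v = 0 := by
  -- Induction on the weight: on a monomial `u` of weight `w` the relation reads `(w + c) R u = 2 R
  -- (J_1 u)`, and `J_1 u` has smaller weight.
  suffices H : ∀ D : ℕ, ∀ v ∈ weightLE D, R v = 0 by
    obtain ⟨D, hD⟩ := exists_mem_weightLE v
    exact H D v hD
  intro D
  induction D using Nat.strong_induction_on with
  | _ D ih =>
    intro v hv
    rw [v.as_sum, map_sum]
    refine Finset.sum_eq_zero fun s hs => ?_
    have hw : (Finsupp.weight (fun m : ℕ => 2 * m + 1) s : ℤ) ≤ D := by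
      rw [weightLE, mem_restrictSupport_iff] at hv
      exact hv hs
    set u : Fock := monomial s (coeff s v)
    have hu : u ∈ weightLE D := by
      rw [weightLE, mem_restrictSupport_iff]
      intro x hx
      have := support_monomial_subset hx
      rw [Finset.mem_singleton] at this
      subst this
      exact hw
    have hJ : R (current 0 u) = 0 := by
      have hm := current_mem_weightLE 0 hu
      rcases lt_or_ge D 2 with hD | hD
      · rw [eq_zero_of_mem_weightLE (by push_cast; omega) hm, map_zero]
      · refine ih (D - 2) (by omega) _ (weightLE_mono ?_ hm)
        push_cast [hD]
        omega
    have hR := h u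
    rw [hJ, weightDerivation_monomial, map_smul, smul_eq_mul, ← add_mul, mul_zero] at hR
    refine (mul_eq_zero.1 hR).resolve_left ?_
    -- Positivity of `c` covers the constant monomial, of weight `0`.
    exact_mod_cast (by omega :
      Finsupp.weight (fun m : ℕ => 2 * m + 1) s + c ≠ 0)

theorem wickDefect_eq_zero (i : ℕ) (v : Fock) : wickDefect i v = 0 := by
  induction i generalizing v with
  | zero =>
    refine eq_zero_of_weightDerivation _ 1 one_pos (fun v => ?_) v
    simpa using wickDefect_zero_weightDerivation v
  | succ i ih =>
    refine eq_zero_of_weightDerivation _ (2 * i + 3) (by omega) (fun v => ?_) v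
    have := wickDefect_succ_weightDerivation i v
    rw [ih, mul_zero, add_zero] at this
    simpa using this

theorem vev_X_mul (i : ℕ) (v : Fock) : vev (X i * v) = vev (contractWith i v) :=
  sub_eq_zero.1 (wickDefect_eq_zero i v)

theorem vev_one : vev 1 = 1 := by
  rw [vev_eq_finsum, finsum_eq_single _ 0]
  · simp
  · intro p hp
    obtain ⟨p, rfl⟩ := Nat.exists_eq_succ_of_ne_zero hp
    rw [Nat.succ_eq_add_one, pow_succ, Module.End.mul_apply, current_zero_apply]
    simp

/-- Removing a factor through `succAbove` matches the minors in `hafnian_succ`. -/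
theorem derivation_prod_fin (δ : Derivation ℂ Fock Fock) {m : ℕ} (f : Fin (m + 1) → Fock) :
    δ (∏ i, f i) = ∑ q, δ (f q) * ∏ i, f (q.succAbove i) := by
  induction m with
  | zero => simp
  | succ m ih =>
    rw [Fin.prod_univ_succ, Derivation.leibniz, ih, add_comm]
    conv_rhs => rw [Fin.sum_univ_succ]
    simp only [Fin.zero_succAbove, smul_eq_mul, Finset.mul_sum]
    refine congrArg₂ (fun x y : Fock => x + y) (mul_comm _ _) (Finset.sum_congr rfl fun q _ => ?_)
    rw [Fin.prod_univ_succ (fun i => f (q.succ.succAbove i))]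
    simp only [Fin.succ_succAbove_zero, Fin.succ_succAbove_succ]
    ring

/-- Wick's theorem for `⟨0| e^{J_1}`. -/
theorem vev_prod_X {k : ℕ} (n : Fin (2 * k) → ℕ) :
    vev (∏ i, X (n i)) = hafnian (Matrix.of fun i j => contraction (n i) (n j)) := by
  induction k with
  | zero =>
    rw [hafnian_zero]
    exact vev_one
  | succ k ih =>
    rw [hafnian_succ]
    refine (congrArg vev (Fin.prod_univ_succ (n := 2 * k + 1) fun i => X (n i))).trans ?_
    rw [vev_X_mul, derivation_prod_fin, map_sum]
    refine Finset.sum_congr rfl fun q _ => ?_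
    rw [contractWith_X, ← smul_eq_C_mul, map_smul, smul_eq_mul, ih]
    -- The remaining variables are indexed by `n ∘ skipTwo q`, by definition.
    rfl

/-! ### The states `|λ⟩` -/

/-- The monomial `φ_{λ_1/2} ⋯ φ_{λ_ℓ/2} |0⟩`. -/
noncomputable def partMonomial (lam : Multiset ℕ) : Fock := (lam.map fun p => (X (p / 2) : Fock)).prod

theorem partMonomial_zero : partMonomial 0 = 1 := rfl

theorem partMonomial_cons (p : ℕ) (lam : Multiset ℕ) :
    partMonomial (p ::ₘ lam) = X (p / 2) * partMonomial lam := by simp [partMonomial]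

theorem coe_partList (lam : Multiset ℕ) : (partList lam : Multiset ℕ) = lam := lam.sort_eq _

theorem length_partList (lam : Multiset ℕ) : (partList lam).length = lam.card := by
  rw [← Multiset.coe_card, coe_partList]

theorem ket_eq (d : ℂ) (lam : Multiset ℕ) : ket d lam = (1 / d) • partMonomial lam := by
  rw [ket]
  congr 1
  have h : ∀ l : List ℕ,
      (l.map fun p => (boson ((p / 2 : ℕ) : ℤ) : Module.End ℂ Fock)).prod vacuum =
        partMonomial (l : Multiset ℕ) := by
    intro l
    induction l with
    | nil => rfl
    | cons p l ih =>
      rw [List.map_cons, List.prod_cons, Module.End.mul_apply, ih, ← Multiset.cons_coe,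
        partMonomial_cons]
      rfl
  rw [h, coe_partList]

theorem polyC_eq (d : ℂ) (lam : Multiset ℕ) :
    polyC d lam (Pi.single 0 1) = (1 / d) * vev (partMonomial lam) := by
  rw [polyC, ket_eq, map_smul, map_smul, smul_eq_mul]
  rfl

theorem partMonomial_eq_prod {lam : Multiset ℕ} {m : ℕ} (h : lam.card = m) :
    partMonomial lam = ∏ i : Fin m, X (halfPart lam i) := by
  subst h
  conv_lhs => rw [← coe_partList lam]
  rw [partMonomial, Multiset.map_coe, Multiset.prod_coe, ← length_partList,
    ← Fin.prod_univ_fun_getElem]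
  -- The index is below the length, so the default `0` in `halfPart` is never read.
  refine Finset.prod_congr rfl fun i _ => ?_
  simp [halfPart]

theorem vev_partMonomial {lam : Multiset ℕ} {k : ℕ} (h : lam.card = 2 * k) :
    vev (partMonomial lam) = hafnian (hookMatrix ℂ lam k) := by
  rw [partMonomial_eq_prod h, vev_prod_X]
  rfl

theorem cast_hafnian_hookMatrix (lam : Multiset ℕ) (k : ℕ) :
    ((hafnian (hookMatrix ℚ lam k) : ℚ) : ℂ) = hafnian (hookMatrix ℂ lam k) := by
  refine (map_hafnian (Rat.castHom ℂ) _).trans (congrArg hafnian ?_)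
  ext i j
  simp [hookMatrix]

/-! ### Pairings -/

/-- Commuting partial derivatives make a fold over an unordered multiset well defined. -/
instance leftCommutative_pderiv : LeftCommutative fun (p : ℕ) (w : Fock) => pderiv (p / 2) w :=
  ⟨fun _ _ _ => pderiv_comm _ _ _⟩

/-- The operator `∏_{p ∈ μ} ∂_{p / 2}`. -/
noncomputable def iterPderiv (mu : Multiset ℕ) (v : Fock) : Fock :=
  mu.foldr (fun (p : ℕ) (w : Fock) => pderiv (p / 2) w) v

@[simp] theorem iterPderiv_zero (v : Fock) : iterPderiv 0 v = v := Multiset.foldr_zero _ _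

@[simp] theorem iterPderiv_cons (p : ℕ) (mu : Multiset ℕ) (v : Fock) :
    iterPderiv (p ::ₘ mu) v = pderiv (p / 2) (iterPderiv mu v) := Multiset.foldr_cons _ _ _ _

theorem iterPderiv_smul (mu : Multiset ℕ) (c : ℂ) (v : Fock) :
    iterPderiv mu (c • v) = c • iterPderiv mu v := by
  induction mu using Multiset.induction_on with
  | empty => simp
  | cons p mu ih => rw [iterPderiv_cons, ih, Derivation.map_smul, iterPderiv_cons]

theorem iterPderiv_pderiv (mu : Multiset ℕ) (m : ℕ) (v : Fock) :
    iterPderiv mu (pderiv m v) = pderiv m (iterPderiv mu v) := by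
  induction mu using Multiset.induction_on with
  | empty => simp
  | cons p mu ih => rw [iterPderiv_cons, ih, pderiv_comm, iterPderiv_cons]

/-- Moving `J_1` to the left past each `∂_{b/2}` costs a term with `b` replaced by `b + 2`. The sum
over the multiset counts balls of one basket separately, as the process does. -/
theorem iterPderiv_current (mu : Multiset ℕ) (v : Fock) :
    iterPderiv mu (current 0 v) = current 0 (iterPderiv mu v) +
      (mu.map fun b => iterPderiv ((b + 2) ::ₘ mu.erase b) v).sum := by
  induction mu using Multiset.induction_on with
  | empty => simp
  | cons p mu ih =>
    have h : (mu.map fun b => iterPderiv ((b + 2) ::ₘ (p ::ₘ mu).erase b) v) =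
        mu.map fun b => pderiv (p / 2) (iterPderiv ((b + 2) ::ₘ mu.erase b) v) := by
      refine Multiset.map_congr rfl fun b hb => ?_
      rw [Multiset.erase_cons_tail_of_mem hb, Multiset.cons_swap, iterPderiv_cons]
    have h' : pderiv (p / 2) ((mu.map fun b => iterPderiv ((b + 2) ::ₘ mu.erase b) v).sum) =
        (mu.map fun b => pderiv (p / 2) (iterPderiv ((b + 2) ::ₘ mu.erase b) v)).sum := by
      rw [map_multiset_sum, Multiset.map_map]
      rfl
    rw [iterPderiv_cons, ih, map_add, pderiv_current, Multiset.map_cons, Multiset.sum_cons, h, h',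
      Multiset.erase_cons_head, iterPderiv_cons, iterPderiv_cons,
      show (p + 2) / 2 = p / 2 + 1 by omega, add_assoc]

theorem leftVacuum_current (v : Fock) :
    leftVacuum (current 0 v) = 1 / 2 * leftVacuum (pderiv 0 (pderiv 0 v)) := by
  rw [current_zero_apply, map_add, leftVacuum_lowering, zero_add, map_smul, smul_eq_mul]

/-- The pairing of `v` with the monomial of `μ`. -/
noncomputable def pairing (mu : Multiset ℕ) (v : Fock) : ℂ := leftVacuum (iterPderiv mu v)

theorem pairing_zero (v : Fock) : pairing 0 v = leftVacuum v := by rw [pairing, iterPderiv_zero]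

theorem pairing_cons (p : ℕ) (mu : Multiset ℕ) (v : Fock) :
    pairing (p ::ₘ mu) v = pairing mu (pderiv (p / 2) v) := by
  rw [pairing, iterPderiv_cons, pairing, iterPderiv_pderiv]

theorem pairing_smul (mu : Multiset ℕ) (c : ℂ) (v : Fock) :
    pairing mu (c • v) = c * pairing mu v := by
  rw [pairing, iterPderiv_smul, map_smul, smul_eq_mul, pairing]

theorem pairing_current (mu : Multiset ℕ) (v : Fock) :
    pairing mu (current 0 v) =
      1 / 2 * pairing (mu + {1, 1}) v +
        (mu.map fun b => pairing ((b + 2) ::ₘ mu.erase b) v).sum := by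
  have h : mu + {1, 1} = 1 ::ₘ 1 ::ₘ mu := by
    rw [add_comm, Multiset.insert_eq_cons, Multiset.cons_add, Multiset.singleton_add]
  rw [pairing, iterPderiv_current, map_add, leftVacuum_current, h, pairing, iterPderiv_cons,
    iterPderiv_cons, map_multiset_sum, Multiset.map_map]
  rfl

theorem multFactorial_cons (p : ℕ) (lam : Multiset ℕ) :
    multFactorial (p ::ₘ lam) = (lam.count p + 1) * multFactorial lam := by
  have hsub : lam.toFinset ⊆ (p ::ₘ lam).toFinset := by
    rw [Multiset.toFinset_cons]
    exact Finset.subset_insert _ _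
  have h : multFactorial lam = ∏ i ∈ (p ::ₘ lam).toFinset, (lam.count i)! := by
    refine Finset.prod_subset hsub fun i _ hi => ?_
    rw [Multiset.mem_toFinset] at hi
    rw [Multiset.count_eq_zero_of_notMem hi, Nat.factorial_zero]
  have hp : p ∈ (p ::ₘ lam).toFinset := by simp
  rw [h, multFactorial, ← Finset.mul_prod_erase _ _ hp, ← Finset.mul_prod_erase _ _ hp,
    Multiset.count_cons_self, Nat.factorial_succ, mul_assoc]
  congr 2
  refine Finset.prod_congr rfl fun i hi => ?_
  rw [Multiset.count_cons_of_ne (Finset.ne_of_mem_erase hi)]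

/-- Oddness makes `p ↦ p / 2` injective, so the exponent of `X (p / 2)` is exactly the multiplicity
of `p`. -/
theorem pderiv_partMonomial {p : ℕ} (hp : Odd p) {lam : Multiset ℕ} (hlam : ∀ q ∈ lam, Odd q) :
    pderiv (p / 2) (partMonomial lam) = (lam.count p : ℂ) • partMonomial (lam.erase p) := by
  induction lam using Multiset.induction_on with
  | empty => simp [partMonomial_zero]
  | cons q lam ih =>
    have ih := ih fun x hx => hlam x (Multiset.mem_cons_of_mem hx)
    rw [partMonomial_cons, Derivation.leibniz, ih, smul_eq_mul, smul_eq_mul, mul_smul_comm]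
    rcases eq_or_ne q p with rfl | hne
    · rw [pderiv_X_self, Multiset.erase_cons_head, Multiset.count_cons_self]
      by_cases hmem : q ∈ lam
      · rw [← partMonomial_cons, Multiset.cons_erase hmem]
        rw [mul_one, Nat.cast_add, Nat.cast_one, add_smul, one_smul]
      · rw [Multiset.count_eq_zero_of_notMem hmem]
        simp
    · have hq := hlam q (Multiset.mem_cons_self _ _)
      have hne' : q / 2 ≠ p / 2 := by
        obtain ⟨a, rfl⟩ := hp
        obtain ⟨b, rfl⟩ := hq
        omega
      rw [pderiv_X_of_ne hne', Multiset.count_cons_of_ne hne.symm,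
        Multiset.erase_cons_tail _ hne, partMonomial_cons, mul_zero, add_zero]

theorem leftVacuum_partMonomial (lam : Multiset ℕ) :
    leftVacuum (partMonomial lam) = if 0 = lam then 1 else 0 := by
  induction lam using Multiset.induction_on with
  | empty => simp [partMonomial_zero]
  | cons p lam _ => simp [partMonomial_cons, (Multiset.cons_ne_zero).symm]

/-- Distinct monomials are orthogonal; stripping parts one at a time multiplies up the
multiplicities to `∏ m_i!`. -/
theorem pairing_partMonomial {mu lam : Multiset ℕ} (hmu : ∀ p ∈ mu, Odd p)
    (hlam : ∀ p ∈ lam, Odd p) :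
    pairing mu (partMonomial lam) = if mu = lam then (multFactorial lam : ℂ) else 0 := by
  induction mu using Multiset.induction_on generalizing lam with
  | empty =>
    rw [pairing_zero, leftVacuum_partMonomial]
    refine if_ctx_congr Iff.rfl (fun h => ?_) fun _ => rfl
    rw [← h]
    simp [multFactorial]
  | cons p mu ih =>
    rw [pairing_cons, pderiv_partMonomial (hmu p (Multiset.mem_cons_self _ _)) hlam, pairing_smul]
    by_cases hmem : p ∈ lam
    · obtain ⟨nu, rfl⟩ := Multiset.exists_cons_of_mem hmem
      rw [Multiset.erase_cons_head, ih (fun q hq => hmu q (Multiset.mem_cons_of_mem hq))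
        (fun q hq => hlam q (Multiset.mem_cons_of_mem hq)), Multiset.count_cons_self,
        multFactorial_cons]
      simp only [Multiset.cons_inj_right, mul_ite, mul_zero]
      push_cast
      rfl
    · rw [Multiset.count_eq_zero_of_notMem hmem, Nat.cast_zero, zero_mul, if_neg]
      rintro rfl
      exact hmem (Multiset.mem_cons_self _ _)

/-! ### Counting histories -/

/-- A history consists of a first step and a shorter history. -/
def historySuccEquiv (T : ℕ) (mu lam : Multiset ℕ) :
    History (T + 1) mu lam ≃
      History T (mu + {1, 1}) lam ⊕ ((b : mu.ToType) × History T ((b.1 + 2) ::ₘ mu.erase b.1) lam) where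
  toFun
    | ⟨.create, h⟩ => .inl h
    | ⟨.move b, h⟩ => .inr ⟨b, h⟩
  invFun
    | .inl h => ⟨.create, h⟩
    | .inr ⟨b, h⟩ => ⟨.move b, h⟩
  left_inv := by rintro ⟨_ | b, h⟩ <;> rfl
  right_inv := by rintro (h | ⟨b, h⟩) <;> rfl

/-- The same recursion as `pairing_current`, except that a creation has weight `1` instead of `1/2`.
-/
theorem card_history_succ (T : ℕ) (mu lam : Multiset ℕ) :
    Nat.card (History (T + 1) mu lam) = Nat.card (History T (mu + {1, 1}) lam) +
      (mu.map fun b => Nat.card (History T ((b + 2) ::ₘ mu.erase b) lam)).sum := by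
  have := History.finite T (mu + {1, 1}) lam
  have : ∀ b : mu.ToType, Finite (History T ((b.1 + 2) ::ₘ mu.erase b.1) lam) :=
    fun b => History.finite _ _ _
  rw [Nat.card_congr (historySuccEquiv T mu lam), Nat.card_sum, Nat.card_sigma,
    ← Multiset.map_univ]
  rfl

theorem card_history_zero (mu lam : Multiset ℕ) :
    Nat.card (History 0 mu lam) = if mu = lam then 1 else 0 := by
  change Nat.card (PLift (mu = lam)) = _
  split_ifs with h <;> simp [h]

/-- A creation adds two balls and a move adds none, so the factors `1/2` depend only on the change
in length. Powers of `r = √2` absorb them without halving or subtracting lengths. -/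
theorem pairing_current_pow {r : ℂ} (hr : r ^ 2 = 2) (T : ℕ) {mu lam : Multiset ℕ}
    (hmu : ∀ p ∈ mu, Odd p) (hlam : ∀ p ∈ lam, Odd p) :
    pairing mu (((current 0 : Module.End ℂ Fock) ^ T) (partMonomial lam)) * r ^ lam.card =
      r ^ mu.card * multFactorial lam * Nat.card (History T mu lam) := by
  induction T generalizing mu with
  | zero =>
    rw [pow_zero, Module.End.one_apply, pairing_partMonomial hmu hlam, card_history_zero]
    split_ifs with h
    · rw [h, Nat.cast_one, mul_one, mul_comm]
    · simp
  | succ T ih =>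
    have h1 := ih (mu := mu + {1, 1}) fun p hp => by
      rcases Multiset.mem_add.1 hp with hp | hp
      · exact hmu p hp
      · have : p = 1 := by simpa using hp
        exact this ▸ odd_one
    have hcard : (mu + {1, 1}).card = mu.card + 2 := by simp
    rw [hcard, pow_add, hr] at h1
    have h2 : ∀ b ∈ mu, pairing ((b + 2) ::ₘ mu.erase b)
        (((current 0 : Module.End ℂ Fock) ^ T) (partMonomial lam)) * r ^ lam.card =
        r ^ mu.card * multFactorial lam *
          (Nat.card (History T ((b + 2) ::ₘ mu.erase b) lam) : ℕ) := by
      intro b hb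
      rw [ih, Multiset.card_cons, Multiset.card_erase_add_one hb]
      intro p hp
      rcases Multiset.mem_cons.1 hp with rfl | hp
      · exact (hmu b hb).add_even even_two
      · exact hmu p (Multiset.mem_of_mem_erase hp)
    rw [pow_succ', Module.End.mul_apply, pairing_current, card_history_succ, add_mul,
      ← Multiset.sum_map_mul_right, Multiset.map_congr rfl h2, Multiset.sum_map_mul_left,
      Nat.cast_add, Nat.cast_multiset_sum, Multiset.map_map]
    simp only [Function.comp_def]
    -- The `r ^ 2 = 2` of the two created balls cancels the `1/2` of the creation term.
    linear_combination (1 / 2 : ℂ) * h1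

/-- Either kind of step raises the weight by `2` and changes the number of balls by `2` or `0`. -/
theorem History.sum_and_parity {T : ℕ} {mu lam : Multiset ℕ} (h : History T mu lam) :
    lam.sum = mu.sum + 2 * T ∧ (Even lam.card ↔ Even mu.card) := by
  induction T generalizing mu with
  | zero =>
    obtain ⟨rfl⟩ := h
    simp
  | succ T ih =>
    obtain ⟨e, h⟩ := h
    have := ih h
    rw [this.1, this.2]
    cases e with
    | create =>
      have hc : (mu + {1, 1}).card = mu.card + 2 := by simp
      have hs : (mu + {1, 1}).sum = mu.sum + 2 := by
        rw [Multiset.sum_add]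
        rfl
      simp only [Event.result, hc, hs]
      exact ⟨by ring, by simp [Nat.even_add]⟩
    | move b =>
      have hb : b.1 ∈ mu := Multiset.coe_mem
      simp only [Event.result, Multiset.card_cons, Multiset.sum_cons,
        Multiset.card_erase_add_one hb]
      refine ⟨?_, trivial⟩
      have := Multiset.sum_erase hb
      omega

theorem isEmpty_history_of_odd {lam : Multiset ℕ} (h : Odd lam.card) (T : ℕ) :
    IsEmpty (History T 0 lam) :=
  ⟨fun x => Nat.not_even_iff_odd.2 h (x.sum_and_parity.2.2 (by simp))⟩

theorem leftVacuum_current_pow {r : ℂ} (hr : r ^ 2 = 2) (T : ℕ) {lam : Multiset ℕ}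
    (hlam : ∀ p ∈ lam, Odd p) :
    leftVacuum (((current 0 : Module.End ℂ Fock) ^ T) (partMonomial lam)) * r ^ lam.card =
      multFactorial lam * Nat.card (History T 0 lam) := by
  have := pairing_current_pow hr T (mu := 0) (by simp) hlam
  simpa [pairing_zero] using this

theorem leftVacuum_current_pow_eq_zero {T : ℕ} {lam : Multiset ℕ} (hlam : ∀ p ∈ lam, Odd p)
    (h : IsEmpty (History T 0 lam)) :
    leftVacuum (((current 0 : Module.End ℂ Fock) ^ T) (partMonomial lam)) = 0 := by
  obtain ⟨r, hr⟩ := IsAlgClosed.exists_pow_nat_eq (2 : ℂ) two_pos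
  have hr0 : r ≠ 0 := by
    rintro rfl
    norm_num at hr
  have := leftVacuum_current_pow hr T hlam
  rw [Nat.card_of_isEmpty, Nat.cast_zero, mul_zero] at this
  exact (mul_eq_zero.1 this).resolve_right (pow_ne_zero _ hr0)

theorem vev_partMonomial_of_odd {lam : Multiset ℕ} (hlam : ∀ p ∈ lam, Odd p)
    (h : Odd lam.card) : vev (partMonomial lam) = 0 := by
  rw [vev_eq_finsum]
  refine finsum_eq_zero_of_forall_eq_zero fun T => ?_
  rw [leftVacuum_current_pow_eq_zero hlam (isEmpty_history_of_odd h T), mul_zero]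

theorem vev_partMonomial_eq_numWays {lam : Multiset ℕ} (hlam : ∀ p ∈ lam, Odd p) {k : ℕ}
    (hk : lam.card = 2 * k) :
    vev (partMonomial lam) =
      (1 / 2 : ℂ) ^ k * (1 / ((lam.sum / 2)! : ℂ)) * multFactorial lam * numWays 0 lam := by
  obtain ⟨r, hr⟩ := IsAlgClosed.exists_pow_nat_eq (2 : ℂ) two_pos
  -- The weight determines the number of steps, so a single term of the exponential series survives.
  rw [vev_eq_finsum, finsum_eq_single _ (lam.sum / 2)]
  · have := leftVacuum_current_pow hr (lam.sum / 2) hlam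
    rw [hk, pow_mul, hr] at this
    rw [numWays, Multiset.sum_zero, Nat.sub_zero, one_div_pow]
    have h2 : (2 : ℂ) ^ k ≠ 0 := pow_ne_zero _ two_ne_zero
    rw [eq_div_of_mul_eq h2 this]
    ring
  · intro T hT
    rw [leftVacuum_current_pow_eq_zero hlam, mul_zero]
    refine ⟨fun x => hT ?_⟩
    have := x.sum_and_parity.1
    rw [Multiset.sum_zero] at this
    omega

/-! ### Comparison of the two evaluations -/

theorem multFactorial_ne_zero (lam : Multiset ℕ) : multFactorial lam ≠ 0 :=
  Finset.prod_ne_zero_iff.2 fun _ _ => Nat.factorial_ne_zero _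

theorem numWays_eq_hafnian {lam : Multiset ℕ} (hlam : ∀ p ∈ lam, Odd p) {k : ℕ}
    (hk : lam.card = 2 * k) :
    (numWays 0 lam : ℚ) = 2 ^ k * ((lam.sum / 2)! : ℚ) * (1 / (multFactorial lam : ℚ)) *
      hafnian (hookMatrix ℚ lam k) := by
  have h := (vev_partMonomial_eq_numWays hlam hk).symm.trans (vev_partMonomial hk)
  have h1 : ((lam.sum / 2)! : ℂ) ≠ 0 := by exact_mod_cast Nat.factorial_ne_zero _
  have h2 : (multFactorial lam : ℂ) ≠ 0 := by exact_mod_cast multFactorial_ne_zero lam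
  have h3 : (2 : ℂ) ^ k ≠ 0 := pow_ne_zero _ two_ne_zero
  -- The rational identity is checked in `ℂ`, where both evaluations of `vev` live.
  apply (Rat.cast_injective : Function.Injective ((↑) : ℚ → ℂ))
  push_cast
  rw [cast_hafnian_hookMatrix, ← h, one_div_pow]
  field_simp

theorem mainTheorem8 (lam : Multiset ℕ) (hlam : ∀ p ∈ lam, Odd p)
    (d : ℂ) (hd : d ^ 2 = normSquare lam) :
    (∀ k : ℕ, lam.card = 2 * k →
      polyC d lam (Pi.single 0 1) =
          (1 / 2 : ℂ) ^ k * (1 / ((lam.sum / 2)! : ℂ)) * ((multFactorial lam : ℂ) / d) *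
            (numWays 0 lam : ℂ) ∧
      polyC d lam (Pi.single 0 1) = (1 / d) * hafnian (hookMatrix ℂ lam k) ∧
      (numWays 0 lam : ℚ) =
          2 ^ k * ((lam.sum / 2)! : ℚ) * (1 / (multFactorial lam : ℚ)) *
            hafnian (hookMatrix ℚ lam k)) ∧
    (Odd lam.card →
      polyC d lam (Pi.single 0 1) = 0 ∧ ∀ T : ℕ, IsEmpty (History T 0 lam)) := by
  refine ⟨fun k hk => ⟨?_, ?_, numWays_eq_hafnian hlam hk⟩, fun h => ⟨?_, isEmpty_history_of_odd h⟩⟩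
  · rw [polyC_eq, vev_partMonomial_eq_numWays hlam hk]
    ring
  · rw [polyC_eq, vev_partMonomial hk]
  · rw [polyC_eq, vev_partMonomial_of_odd hlam h, mul_zero]
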